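/- Let $(R,\mathfrak m)$ be a Cohen–Macaulay local ring of dimension one possessing a canonical module $\omega_R$ (a maximal Cohen–Macaulay $R$-module of type one and of finite injective dimension). Let $Q(R)$ be the total ring of fractions of $R$ and $\overline R$ the integral closure of $R$ in $Q(R)$. Let $\mathrm{tr}_R(\omega_R)=\sum_{f\in \mathrm{Hom}_R(\omega_R,R)}\mathrm{Im} f$ be the trace ideal of $\omega_R$, and put $R:\overline R=\{\alpha\in Q(R)\mid \alpha\overline R\subseteq R\}$. Suppose that (a) $C$ is an $R$-submodule of $Q(R)$ with $R\subseteq C\subseteq\overline R$ and $C\cong\omega_R$ as $R$-modules; (b) $\overline R$ is finitely generated as an $R$-module; (c) $\overline R$ is a local ring. Then the following conditions are equivalent: (i) $R$ is a far-flung Gorenstein ring, that is, $\mathrm{tr}_R(\omega_R)=R:\overline R$; (ii) $\mathrm{tr}_R(\omega_R)\cong\overline R$ as $R$-modules; (iii) $C^2=\overline R$, where $C^2$ is the $R$-submodule of $Q(R)$ generated by all products of two elements of $C$. -/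

import Mathlib

open CategoryTheory

universe u v

/-- The trace ideal `tr_R(M)`: the sum of the images of all `R`-linear maps `M → R`. -/
def traceIdeal (R : Type u) [CommRing R] (M : Type v) [AddCommGroup M] [Module R M] : Ideal R :=
  ⨆ f : M →ₗ[R] R, LinearMap.range f

/-- A module over a Noetherian local ring `R` is maximal Cohen-Macaulay if it is finitely
generated and admits a regular sequence in the maximal ideal whose length is `dim R`
(`IsRegular` includes `M ≠ (rs) M`, so `M` is non-zero). -/
def IsMaximalCohenMacaulay (R : Type u) [CommRing R] [IsLocalRing R]
    (M : Type v) [AddCommGroup M] [Module R M] : Prop :=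
  Module.Finite R M ∧
    ∃ rs : List R, (rs.length : WithBot ℕ∞) = ringKrullDim R ∧
      (∀ r ∈ rs, r ∈ IsLocalRing.maximalIdeal R) ∧ RingTheory.Sequence.IsRegular M rs

/-- A Cohen-Macaulay local ring: a Noetherian local ring that has a regular sequence in its
maximal ideal of length `dim R`. -/
def IsCohenMacaulayLocalRing (R : Type u) [CommRing R] [IsLocalRing R] : Prop :=
  IsNoetherianRing R ∧ IsMaximalCohenMacaulay R R

/-- For a maximal Cohen-Macaulay module `M` over a local ring `R` of dimension `d` with residue
field `k`: the type `dim_k Ext^d_R(k, M)` of `M` equals one. -/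
def HasTypeOne (R : Type u) [CommRing R] [IsLocalRing R]
    (M : Type u) [AddCommGroup M] [Module R M] : Prop :=
  ∃ d : ℕ, ringKrullDim R = d ∧
    Nonempty (Abelian.Ext (ModuleCat.of R (IsLocalRing.ResidueField R)) (ModuleCat.of R M) d
      ≃ₗ[R] IsLocalRing.ResidueField R)

/-- A canonical module of a Cohen-Macaulay local ring: a maximal Cohen-Macaulay module of type
one and of finite injective dimension. -/
structure IsCanonicalModule (R : Type u) [CommRing R] [IsLocalRing R]
    (ω : Type u) [AddCommGroup ω] [Module R ω] : Prop where
  isMaximalCohenMacaulay : IsMaximalCohenMacaulay R ω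
  hasTypeOne : HasTypeOne R ω
  finite_injectiveDimension : ∃ n : ℕ, HasInjectiveDimensionLE (ModuleCat.of R ω) n

/-- The integral closure of `R` in its total ring of fractions `Q`, as an `R`-submodule of `Q`. -/
def integralClosureSubmodule (R : Type u) [CommRing R] (Q : Type v) [CommRing Q] [Algebra R Q] :
    Submodule R Q :=
  Subalgebra.toSubmodule (integralClosure R Q)

/-- `R` (with canonical module `ω` and total ring of fractions `Q`) is far-flung Gorenstein if
`tr_R(ω) = R : R̄`, an equality of `R`-submodules of `Q`. The submodule `1` of `Q` is the image
of `R`, and `I / J = {α ∈ Q | α J ⊆ I}` is the colon `I : J`. -/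
def IsFarFlungGorenstein (R : Type u) [CommRing R] (ω : Type u) [AddCommGroup ω] [Module R ω]
    (Q : Type v) [CommRing Q] [Algebra R Q] : Prop :=
  IsLocalization.coeSubmodule Q (traceIdeal R ω) =
    (1 : Submodule R Q) / integralClosureSubmodule R Q

/-! Write `B` for the integral closure. Finiteness of `B` forces `Q` to be reduced, hence Artinian
reduced, and locality of `B` leaves no nontrivial idempotents. So `Q` is a field and `R` a domain,
and maps between fractional ideals are multiplications.

The key is duality. Finite injective dimension kills Ext² into `C`, so every map from an ideal to `K
/ C` lifts to `K` and is a multiplication. As `K / C` contains the residue field, `X ↦ C / X`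
separates nested finitely generated submodules (`eq_of_div_eq_div`); in particular `C / C = 1`.

Hence `1 / C = C / C ^ 2` and `1 / B = C / B`, while the trace ideal is `(1 / C) * C`. Comparing `C
^ 2` with `B` through their duals gives (i) ↔ (iii). For (i) ↔ (ii), `B` is a principal ideal
domain, so the conductor `1 / B` is a multiple of `B`; conversely, a trace ideal of the form `q B`
is stable under `B`, hence lies in the conductor. -/

/-! ### Vanishing of Ext into modules of finite injective dimension. -/

section ExtVanishing

open Abelian

variable {R : Type u} [CommRing R]

/-- The short complex of modules attached to a pair of maps that is exact in the middle. -/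
abbrev exactShortComplex {A B D : Type u} [AddCommGroup A] [Module R A] [AddCommGroup B]
    [Module R B] [AddCommGroup D] [Module R D] (f : A →ₗ[R] B) (g : B →ₗ[R] D)
    (h : Function.Exact f g) : ShortComplex (ModuleCat.{u} R) :=
  ModuleCat.shortComplexOfCompEqZero f g h.linearMap_comp_eq_zero

lemma exactShortComplex_shortExact {A B D : Type u} [AddCommGroup A] [Module R A] [AddCommGroup B]
    [Module R B] [AddCommGroup D] [Module R D] (f : A →ₗ[R] B) (g : B →ₗ[R] D)
    (h : Function.Exact f g) (hf : Function.Injective f) (hg : Function.Surjective g) :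
    (exactShortComplex f g h).ShortExact :=
  ModuleCat.shortComplex_shortExact _ h hf hg

lemma subsingleton_ext_X₂ {S : ShortComplex (ModuleCat.{u} R)} (hS : S.ShortExact)
    (N : ModuleCat.{u} R) (n : ℕ) (h₁ : Subsingleton (Ext S.X₁ N n))
    (h₃ : Subsingleton (Ext S.X₃ N n)) : Subsingleton (Ext S.X₂ N n) := by
  refine subsingleton_of_forall_eq 0 fun x ↦ ?_
  obtain ⟨y, rfl⟩ := Ext.contravariant_sequence_exact₂ hS N x (Subsingleton.elim _ _)
  rw [Subsingleton.elim y 0, Ext.comp_zero]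

lemma subsingleton_ext_X₁ {S : ShortComplex (ModuleCat.{u} R)} (hS : S.ShortExact)
    (N : ModuleCat.{u} R) (n : ℕ) (h₂ : Subsingleton (Ext S.X₂ N n))
    (h₃ : Subsingleton (Ext S.X₃ N (n + 1))) : Subsingleton (Ext S.X₁ N n) := by
  refine subsingleton_of_forall_eq 0 fun x ↦ ?_
  obtain ⟨y, rfl⟩ := Ext.contravariant_sequence_exact₁ hS N x (add_comm 1 n)
    (Subsingleton.elim _ _)
  rw [Subsingleton.elim y 0, Ext.comp_zero]

lemma subsingleton_ext_X₃ {S : ShortComplex (ModuleCat.{u} R)} (hS : S.ShortExact)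
    (N : ModuleCat.{u} R) (n : ℕ) (h₁ : Subsingleton (Ext S.X₁ N n))
    (h₂ : Subsingleton (Ext S.X₂ N (n + 1))) : Subsingleton (Ext S.X₃ N (n + 1)) := by
  refine subsingleton_of_forall_eq 0 fun x ↦ ?_
  obtain ⟨y, rfl⟩ := Ext.contravariant_sequence_exact₃ hS N x (Subsingleton.elim _ _)
    (add_comm 1 n)
  rw [Subsingleton.elim y 0, Ext.comp_zero]

lemma subsingleton_ext_of_projective (M : Type u) [AddCommGroup M] [Module R M]
    [Module.Projective R M] (N : ModuleCat.{u} R) (n : ℕ) :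
    Subsingleton (Ext (ModuleCat.of R M) N (n + 1)) :=
  have := (IsProjective.iff_projective M).1 ‹Module.Projective R M›
  Ext.subsingleton_of_projective _ _ _

lemma subsingleton_ext_of_linearEquiv {A B : Type u} [AddCommGroup A] [Module R A]
    [AddCommGroup B] [Module R B] (e : A ≃ₗ[R] B) (N : ModuleCat.{u} R) (n : ℕ)
    (h : Subsingleton (Ext (ModuleCat.of R B) N n)) :
    Subsingleton (Ext (ModuleCat.of R A) N n) := by
  refine subsingleton_of_forall_eq 0 fun x ↦ ?_
  have : x = (Ext.mk₀ e.toModuleIso.hom).comp ((Ext.mk₀ e.toModuleIso.inv).comp x (zero_add n))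
      (zero_add n) := by
    rw [Ext.mk₀_comp_mk₀_assoc, Iso.hom_inv_id, Ext.mk₀_id_comp]
  rw [this, Subsingleton.elim ((Ext.mk₀ e.toModuleIso.inv).comp x (zero_add n)) 0, Ext.comp_zero]

lemma exact_mul_span_mkQ (x : R) :
    Function.Exact (LinearMap.mulLeft R x) (Ideal.span {x}).mkQ := by
  intro y
  rw [Submodule.mkQ_apply, Submodule.Quotient.mk_eq_zero, Ideal.mem_span_singleton']
  simp [mul_comm, eq_comm]

/-- Multiplication by a regular element gives a free resolution of length one. -/
lemma subsingleton_ext_quotient_span [IsDomain R] {x : R} (hx : x ≠ 0) (N : ModuleCat.{u} R)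
    (n : ℕ) : Subsingleton (Ext (ModuleCat.of R (R ⧸ Ideal.span {x})) N (n + 2)) :=
  subsingleton_ext_X₃ (exactShortComplex_shortExact (LinearMap.mulLeft R x) (Ideal.span {x}).mkQ
    (exact_mul_span_mkQ x) (mul_right_injective₀ hx) (Submodule.mkQ_surjective _)) N (n + 1)
    (subsingleton_ext_of_projective R N n) (subsingleton_ext_of_projective R N (n + 1))

/-- An associated prime of `R ⧸ (x)` contains `x ≠ 0`, so it is maximal in dimension at most one. -/
lemma exists_injective_residueField_quotient_span [IsNoetherianRing R] [IsLocalRing R]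
    [Ring.DimensionLEOne R] {x : R} (hx : x ≠ 0) (hxm : x ∈ IsLocalRing.maximalIdeal R) :
    ∃ f : (R ⧸ IsLocalRing.maximalIdeal R) →ₗ[R] (R ⧸ Ideal.span {x}), Function.Injective f := by
  have hne : Ideal.span {x} ≠ ⊤ := fun h ↦ by
    rw [Ideal.span_singleton_eq_top] at h
    exact (IsLocalRing.mem_maximalIdeal x).1 hxm h
  have := Ideal.Quotient.nontrivial_iff.2 hne
  obtain ⟨p, hp⟩ := associatedPrimes.nonempty R (R ⧸ Ideal.span {x})
  obtain ⟨hp', f, hf⟩ := (isAssociatedPrime_iff_exists_injective_linearMap _ _).1 hp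
  have hxp : x ∈ p := by
    rw [← Submodule.Quotient.mk_eq_zero p]
    refine hf ?_
    have : (Submodule.Quotient.mk x : R ⧸ p) = x • Submodule.Quotient.mk 1 := by
      rw [← Submodule.Quotient.mk_smul, smul_eq_mul, mul_one]
    rw [map_zero, this, map_smul]
    obtain ⟨y, hy⟩ := Submodule.Quotient.mk_surjective _ (f (Submodule.Quotient.mk 1))
    rw [← hy, ← Submodule.Quotient.mk_smul, Submodule.Quotient.mk_eq_zero]
    exact Ideal.mem_span_singleton'.2 ⟨y, mul_comm _ _⟩
  have hpm : p = IsLocalRing.maximalIdeal R :=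
    IsLocalRing.eq_maximalIdeal (hp'.isMaximal fun h ↦ hx (by simpa [h] using hxp))
  subst hpm
  exact ⟨f, hf⟩

/-- Over a one-dimensional Noetherian local domain, a module of finite injective dimension has
vanishing second extension groups with finitely generated modules. -/
theorem subsingleton_ext_two_of_hasInjectiveDimensionLE [IsDomain R] [IsNoetherianRing R]
    [IsLocalRing R] [Ring.DimensionLEOne R] (hR : IsLocalRing.maximalIdeal R ≠ ⊥)
    (N : ModuleCat.{u} R) (n : ℕ) [hN : HasInjectiveDimensionLE N n]
    (M : Type u) [AddCommGroup M] [Module R M] [Module.Finite R M] :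
    Subsingleton (Ext (ModuleCat.of R M) N 2) := by
  obtain ⟨x, hxm, hx⟩ := Submodule.exists_mem_ne_zero_of_ne_bot hR
  obtain ⟨f, hf⟩ := exists_injective_residueField_quotient_span hx hxm
  -- Vanishing descends one degree: Ext of the residue field sits between Ext of `R ⧸ (x)`, zero
  -- from degree 2 on, and the next Ext of the cokernel of `f`. A prime filtration then reaches
  -- every `M`, since the only primes are zero and the maximal ideal.
  have step (k : ℕ) (hk : ∀ (M : Type u) [AddCommGroup M] [Module R M] [Module.Finite R M],
      Subsingleton (Ext (ModuleCat.of R M) N (k + 3)))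
      (M : Type u) [AddCommGroup M] [Module R M] [Module.Finite R M] :
      Subsingleton (Ext (ModuleCat.of R M) N (k + 2)) := by
    have hres : Subsingleton (Ext (ModuleCat.of R (R ⧸ IsLocalRing.maximalIdeal R)) N (k + 2)) :=
      subsingleton_ext_X₁ (exactShortComplex_shortExact f (LinearMap.range f).mkQ
        (LinearMap.exact_map_mkQ_range f) hf (Submodule.mkQ_surjective _)) N (k + 2)
        (subsingleton_ext_quotient_span hx N k) (hk _)
    induction ‹Module.Finite R M› using
      IsNoetherianRing.induction_on_isQuotientEquivQuotientPrime R with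
    | subsingleton M => exact subsingleton_ext_of_projective M N (k + 1)
    | quotient M p e =>
      by_cases hp : p.1 = ⊥
      · have : Module.Projective R M :=
          .of_equiv (e.trans ((Submodule.quotEquivOfEq _ _ hp).trans
            (Submodule.quotEquivOfEqBot ⊥ rfl))).symm
        exact subsingleton_ext_of_projective M N (k + 1)
      · have hpm := IsLocalRing.eq_maximalIdeal (p.2.isMaximal hp)
        exact subsingleton_ext_of_linearEquiv (e.trans (Submodule.quotEquivOfEq _ _ hpm)) N _ hres
    | exact M₁ M₂ M₃ f g hf hg hfg h₁ h₃ =>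
      exact subsingleton_ext_X₂ (exactShortComplex_shortExact f g hfg hf hg) N _ h₁ h₃
  -- Descending induction on the degree `j + 2`; `k` bounds the number of uses of `step` before the
  -- degree exceeds the injective dimension.
  have key (k : ℕ) : ∀ j, n + 1 ≤ k + j → ∀ (M : Type u) [AddCommGroup M] [Module R M]
      [Module.Finite R M], Subsingleton (Ext (ModuleCat.of R M) N (j + 2)) := by
    induction k with
    | zero => intro j hj M _ _ _; exact HasInjectiveDimensionLT.subsingleton N (n + 1) _ (by omega) _
    | succ k ih => intro j hj; exact step j (ih (j + 1) (by omega))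
  exact key (n + 1) 0 le_rfl M

/-- If `Ext¹(M, A) = 0`, then linear maps out of `M` lift along surjections with kernel `A`. -/
lemma exists_lift_of_subsingleton_ext_one {A B D M : Type u} [AddCommGroup A] [Module R A]
    [AddCommGroup B] [Module R B] [AddCommGroup D] [Module R D] [AddCommGroup M] [Module R M]
    (f : A →ₗ[R] B) (g : B →ₗ[R] D) (h : Function.Exact f g) (hf : Function.Injective f)
    (hg : Function.Surjective g)
    (hM : Subsingleton (Ext (ModuleCat.of R M) (ModuleCat.of R A) 1)) (φ : M →ₗ[R] D) :
    ∃ ψ : M →ₗ[R] B, g ∘ₗ ψ = φ := by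
  obtain ⟨y, hy⟩ := Ext.covariant_sequence_exact₃ (ModuleCat.of R M)
    (exactShortComplex_shortExact f g h hf hg) (Ext.mk₀ (ModuleCat.ofHom φ)) (zero_add 1)
    (Subsingleton.elim _ _)
  obtain ⟨ψ, rfl⟩ := Ext.homEquiv₀.symm.surjective y
  refine ⟨ψ.hom, ?_⟩
  have := Ext.homEquiv₀.symm.injective (a₁ := ψ ≫ ModuleCat.ofHom g) (a₂ := ModuleCat.ofHom φ)
    (by simpa using! hy)
  exact congrArg ModuleCat.Hom.hom this

end ExtVanishing

/-! ### Duality into a canonical fractional ideal. -/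

section FractionalIdeals

open Abelian

variable {R : Type u} [CommRing R]

lemma exists_injective_residueField_quotient [IsNoetherianRing R] [IsLocalRing R]
    [Ring.DimensionLEOne R] (hR : IsLocalRing.maximalIdeal R ≠ ⊥)
    {K : Type v} [Field K] [Algebra R K] [IsFractionRing R K] {C : Submodule R K}
    (hC : C.FG) (h1C : 1 ≤ C) :
    ∃ f : (R ⧸ IsLocalRing.maximalIdeal R) →ₗ[R] K ⧸ C, Function.Injective f := by
  obtain ⟨x, hxm, hx⟩ := Submodule.exists_mem_ne_zero_of_ne_bot hR
  -- Since `x K = K`, Nakayama prevents the nonzero module `K` from being finitely generated.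
  have hne : C ≠ ⊤ := by
    rintro rfl
    have hx' : algebraMap R K x ≠ 0 := by simpa using hx
    have := Submodule.eq_bot_of_le_smul_of_le_jacobson_bot (IsLocalRing.maximalIdeal R) _ hC
      (fun y _ ↦ by
        have : x • ((algebraMap R K x)⁻¹ * y) ∈
            IsLocalRing.maximalIdeal R • (⊤ : Submodule R K) :=
          Submodule.smul_mem_smul hxm Submodule.mem_top
        rwa [Algebra.smul_def x, mul_inv_cancel_left₀ hx'] at this)
      (IsLocalRing.maximalIdeal_le_jacobson _)
    exact top_ne_bot this
  have := Submodule.Quotient.nontrivial_iff.2 hne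
  obtain ⟨p, hp⟩ := associatedPrimes.nonempty R (K ⧸ C)
  obtain ⟨hp', f, hf⟩ := (isAssociatedPrime_iff_exists_injective_linearMap _ _).1 hp
  obtain ⟨y, hy⟩ := C.mkQ_surjective (f (Submodule.Quotient.mk 1))
  obtain ⟨r, s, hs, rfl⟩ := IsFractionRing.div_surjective (A := R) y
  have hs' : algebraMap R K s ≠ 0 := by simpa using nonZeroDivisors.ne_zero hs
  -- The class of `r / s` is killed by `s`, because `R ≤ C`; so `p` is nonzero, hence maximal.
  have hsp : s ∈ p := by
    rw [← Submodule.Quotient.mk_eq_zero p]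
    refine hf ?_
    have : (Submodule.Quotient.mk s : R ⧸ p) = s • Submodule.Quotient.mk 1 := by
      rw [← Submodule.Quotient.mk_smul, smul_eq_mul, mul_one]
    rw [map_zero, this, map_smul, ← hy, ← map_smul, Submodule.mkQ_apply,
      Submodule.Quotient.mk_eq_zero, Algebra.smul_def, mul_div_cancel₀ _ hs']
    exact h1C (Submodule.mem_one.2 ⟨r, rfl⟩)
  have hpm : p = IsLocalRing.maximalIdeal R :=
    IsLocalRing.eq_maximalIdeal (hp'.isMaximal fun h ↦
      nonZeroDivisors.ne_zero hs (by simpa [h] using hsp))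
  subst hpm
  exact ⟨f, hf⟩

/-- Finite generation puts `N` inside a maximal proper submodule, whose quotient is simple and thus
the residue field. -/
lemma exists_linearMap_residueField_ne_zero {A M : Type*} [CommRing A] [IsLocalRing A]
    [AddCommGroup M] [Module A M] [Module.Finite A M] {N : Submodule A M} (hN : N ≠ ⊤) :
    ∃ f : M →ₗ[A] A ⧸ IsLocalRing.maximalIdeal A, N ≤ LinearMap.ker f ∧ f ≠ 0 := by
  obtain ⟨P, hP, hNP⟩ := (eq_top_or_exists_le_coatom N).resolve_left hN
  have := isSimpleModule_iff_isCoatom.2 hP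
  obtain ⟨m, hm, ⟨e⟩⟩ := isSimpleModule_iff_quot_maximal.1 this
  obtain rfl := IsLocalRing.eq_maximalIdeal hm
  refine ⟨e.toLinearMap ∘ₗ P.mkQ, fun x hx ↦ ?_, fun h ↦ hP.1 ?_⟩
  · rw [LinearMap.mem_ker, LinearMap.comp_apply, Submodule.mkQ_apply,
      (Submodule.Quotient.mk_eq_zero P).2 (hNP hx), map_zero]
  · refine eq_top_iff.2 fun x _ ↦ ?_
    have := LinearMap.congr_fun h x
    simpa using this

variable [IsDomain R]

/-- A linear map between fractional ideals is multiplication by an element of the field. -/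
lemma exists_eq_mul_of_linearMap {K : Type v} [Field K] [Algebra R K] [IsFractionRing R K]
    {Y : Submodule R K} (f : Y →ₗ[R] K) : ∃ q : K, ∀ y : Y, f y = q * y := by
  by_cases hY : ∃ y₀ : Y, y₀ ≠ 0
  · obtain ⟨y₀, hy₀⟩ := hY
    have hy₀' : (y₀ : K) ≠ 0 := by simpa using hy₀
    refine ⟨f y₀ / y₀, fun y ↦ ?_⟩
    -- Any `y` is `R`-proportional to `y₀`, via `s y = r y₀`, so the value at `y₀` determines `f`.
    obtain ⟨r, s, hs, hrs⟩ := IsFractionRing.div_surjective (A := R) ((y : K) / y₀)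
    have hs' : algebraMap R K s ≠ 0 := by simpa using nonZeroDivisors.ne_zero hs
    have hsy : s • y = r • y₀ := by
      ext
      simp only [Submodule.coe_smul, Algebra.smul_def]
      field_simp at hrs
      rw [← hrs]
    have h := congrArg f hsy
    have h' := congrArg (Subtype.val : Y → K) hsy
    simp only [map_smul, Submodule.coe_smul, Algebra.smul_def] at h h'
    field_simp
    refine mul_left_cancel₀ hs' ?_
    linear_combination (y₀ : K) * h - f y₀ * h'
  · push Not at hY
    exact ⟨0, fun y ↦ by rw [hY y]; simp⟩

/-- Every linear map from an ideal to `K / C` is multiplication by an element of `K` when `C` has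
finite injective dimension. -/
lemma exists_eq_mk_mul_of_hasInjectiveDimensionLE [IsNoetherianRing R] [IsLocalRing R]
    [Ring.DimensionLEOne R] (hR : IsLocalRing.maximalIdeal R ≠ ⊥)
    {K : Type u} [Field K] [Algebra R K] [IsFractionRing R K] (C : Submodule R K) (n : ℕ)
    [HasInjectiveDimensionLE (ModuleCat.of R C) n] (I : Ideal R) (φ : I →ₗ[R] K ⧸ C) :
    ∃ q : K, ∀ x : I, φ x = C.mkQ (q * algebraMap R K x) := by
  -- Dimension shift along `I → R → R ⧸ I`, using Ext²(`R ⧸ I`, `C`) = 0.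
  have hExt : Subsingleton (Ext (ModuleCat.of R I) (ModuleCat.of R C) 1) :=
    subsingleton_ext_X₁ (exactShortComplex_shortExact I.subtype I.mkQ
      (LinearMap.exact_subtype_mkQ I) I.injective_subtype (Submodule.mkQ_surjective _)) _ 1
      (subsingleton_ext_of_projective R _ 0)
      (subsingleton_ext_two_of_hasInjectiveDimensionLE hR _ n _)
  obtain ⟨ψ, rfl⟩ := exists_lift_of_subsingleton_ext_one C.subtype C.mkQ
    (LinearMap.exact_subtype_mkQ C) C.injective_subtype (Submodule.mkQ_surjective _) hExt φ
  let e : I ≃ₗ[R] IsLocalization.coeSubmodule K I :=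
    Submodule.equivMapOfInjective _ (IsFractionRing.injective R K) I
  obtain ⟨q, hq⟩ := exists_eq_mul_of_linearMap (ψ ∘ₗ e.symm.toLinearMap)
  refine ⟨q, fun x ↦ ?_⟩
  have := hq (e x)
  simp only [LinearMap.comp_apply, LinearEquiv.coe_coe, LinearEquiv.symm_apply_apply] at this
  rw [LinearMap.comp_apply, this]
  rfl

/-- Universe-polymorphic form of `exists_eq_mk_mul_of_hasInjectiveDimensionLE`. -/
lemma exists_eq_mk_mul_of_linearEquiv [IsNoetherianRing R] [IsLocalRing R]
    [Ring.DimensionLEOne R] (hR : IsLocalRing.maximalIdeal R ≠ ⊥)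
    {K : Type v} [Field K] [Algebra R K] [IsFractionRing R K] {C : Submodule R K}
    {ω : Type u} [AddCommGroup ω] [Module R ω] (e : C ≃ₗ[R] ω) (n : ℕ)
    [hω : HasInjectiveDimensionLE (ModuleCat.of R ω) n] (I : Ideal R) (φ : I →ₗ[R] K ⧸ C) :
    ∃ q : K, ∀ x : I, φ x = C.mkQ (q * algebraMap R K x) := by
  -- `FractionRing R` lies in the universe of `R`, where the Ext argument applies.
  let a : K ≃ₐ[R] FractionRing R := (FractionRing.algEquiv R K).symm
  let C' := C.map a.toLinearEquiv.toLinearMap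
  let ec : C' ≃ₗ[R] ω := (a.toLinearEquiv.submoduleMap C).symm.trans e
  have : HasInjectiveDimensionLE (ModuleCat.of R C') n :=
    hasInjectiveDimensionLT_of_iso ec.symm.toModuleIso (n + 1)
  let b : (K ⧸ C) ≃ₗ[R] FractionRing R ⧸ C' := Submodule.Quotient.equiv C C' a.toLinearEquiv rfl
  obtain ⟨q, hq⟩ := exists_eq_mk_mul_of_hasInjectiveDimensionLE hR C' n I (b.toLinearMap ∘ₗ φ)
  refine ⟨a.symm q, fun x ↦ b.injective ?_⟩
  refine (hq x).trans ?_
  change _ = C'.mkQ (a (a.symm q * algebraMap R K x))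
  simp

/-- Duality into a canonical fractional ideal separates finitely generated submodules. -/
theorem eq_of_div_eq_div [IsNoetherianRing R] [IsLocalRing R]
    [Ring.DimensionLEOne R] (hR : IsLocalRing.maximalIdeal R ≠ ⊥)
    {K : Type v} [Field K] [Algebra R K] [IsFractionRing R K] {C : Submodule R K}
    {ω : Type u} [AddCommGroup ω] [Module R ω] (e : C ≃ₗ[R] ω) (n : ℕ)
    [HasInjectiveDimensionLE (ModuleCat.of R ω) n] (hC : C.FG) (h1C : 1 ≤ C)
    {X Y : Submodule R K} (hY : Y.FG) (hXY : X ≤ Y) (h : C / X = C / Y) : X = Y := by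
  by_contra hne
  have : Module.Finite R Y := Module.Finite.iff_fg.2 hY
  have hX : X.submoduleOf Y ≠ ⊤ := fun h ↦ hne (hXY.antisymm (Submodule.submoduleOf_eq_top.1 h))
  obtain ⟨f, hXf, hf0⟩ := exists_linearMap_residueField_ne_zero hX
  obtain ⟨g, hg⟩ := exists_injective_residueField_quotient hR hC h1C
  obtain ⟨s, hs, hsY⟩ := FractionalIdeal.isFractional_of_fg (S := nonZeroDivisors R) hY
  have hs' : algebraMap R K s ≠ 0 := by simpa using nonZeroDivisors.ne_zero hs
  -- `s` is a common denominator of `Y`, so `I` corresponds to `s Y` and `ι` is division by `s`. A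
  -- nonzero map from `Y` through the residue field to `K / C`, killing `X`, thus becomes
  -- multiplication by `q s`, which sends `X` into `C` but not `Y`.
  let I : Ideal R := Y.comap ((algebraMap R K s)⁻¹ • Algebra.linearMap R K)
  let ι : I →ₗ[R] Y := ((algebraMap R K s)⁻¹ • Algebra.linearMap R K).restrict fun _ hx ↦ hx
  obtain ⟨q, hq⟩ := exists_eq_mk_mul_of_linearEquiv hR e n I (g ∘ₗ f ∘ₗ ι)
  have key (y : Y) : g (f y) = C.mkQ (q * algebraMap R K s * y) := by
    obtain ⟨r, hr⟩ := hsY y y.2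
    have hy : (y : K) = (algebraMap R K s)⁻¹ * algebraMap R K r := by
      rw [hr, Algebra.smul_def, inv_mul_cancel_left₀ hs']
    have hrI : r ∈ I := by
      change (algebraMap R K s)⁻¹ * algebraMap R K r ∈ Y
      rw [← hy]; exact y.2
    have hι : ι ⟨r, hrI⟩ = y := Subtype.ext hy.symm
    have := hq ⟨r, hrI⟩
    rw [LinearMap.comp_apply, LinearMap.comp_apply, hι] at this
    rw [this, hr, Algebra.smul_def, mul_assoc]
  have hqX : q * algebraMap R K s ∈ C / X := by
    refine Submodule.mem_div_iff_forall_mul_mem.2 fun x hx ↦ ?_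
    rw [← Submodule.Quotient.mk_eq_zero C, ← Submodule.mkQ_apply, ← key ⟨x, hXY hx⟩,
      LinearMap.mem_ker.1 (hXf (show (⟨x, hXY hx⟩ : Y) ∈ X.submoduleOf Y from hx)), map_zero]
  rw [h, Submodule.mem_div_iff_forall_mul_mem] at hqX
  refine hf0 (LinearMap.ext fun y ↦ hg ?_)
  rw [key, Submodule.mkQ_apply, (Submodule.Quotient.mk_eq_zero C).2 (hqX y y.2)]
  simp

/-- A canonical fractional ideal has endomorphism ring `R`. -/
theorem div_self_eq_one [IsNoetherianRing R] [IsLocalRing R]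
    [Ring.DimensionLEOne R] (hR : IsLocalRing.maximalIdeal R ≠ ⊥)
    {K : Type v} [Field K] [Algebra R K] [IsFractionRing R K] {C : Submodule R K}
    {ω : Type u} [AddCommGroup ω] [Module R ω] (e : C ≃ₗ[R] ω) (n : ℕ)
    [HasInjectiveDimensionLE (ModuleCat.of R ω) n] (hC : C.FG) (h1C : 1 ≤ C) :
    C / C = 1 := by
  have : IsNoetherian R C := isNoetherian_of_fg_of_noetherian C hC
  have h1 : C / C ≤ C := fun x hx ↦ by
    simpa using Submodule.mem_div_iff_forall_mul_mem.1 hx 1 (h1C (Submodule.one_le.1 le_rfl))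
  -- Separation applies to `1 ≤ C / C`, as both have dual `C`.
  refine (eq_of_div_eq_div hR e n hC h1C (Submodule.FG.of_le hC h1)
    (Submodule.one_mem_div.2 le_rfl |> Submodule.one_le.2) (le_antisymm ?_ ?_)).symm
  · intro x hx
    have hx' : x ∈ C := by
      simpa using Submodule.mem_div_iff_forall_mul_mem.1 hx 1 (Submodule.one_le.1 le_rfl)
    refine Submodule.mem_div_iff_forall_mul_mem.2 fun y hy ↦ ?_
    rw [mul_comm]
    exact Submodule.mem_div_iff_forall_mul_mem.1 hy x hx'
  · intro x hx
    refine Submodule.mem_div_iff_forall_mul_mem.2 fun y hy ↦ ?_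
    exact Submodule.mem_div_iff_forall_mul_mem.1 hx y
      ((Submodule.one_le.2 (Submodule.one_mem_div.2 le_rfl)) hy)

end FractionalIdeals

/-! ### The trace ideal as a product of fractional ideals. -/

section TraceIdeal

variable {R : Type u} [CommRing R] [IsDomain R]

/-- The trace ideal of a fractional ideal. -/
theorem coeSubmodule_traceIdeal_eq {K : Type v} [Field K] [Algebra R K] [IsFractionRing R K]
    {C : Submodule R K} {ω : Type u} [AddCommGroup ω] [Module R ω] (e : C ≃ₗ[R] ω) :
    IsLocalization.coeSubmodule K (traceIdeal R ω) = (1 / C) * C := by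
  apply le_antisymm
  · rw [IsLocalization.coeSubmodule, traceIdeal, Submodule.map_iSup]
    refine iSup_le fun f ↦ ?_
    -- Through `e`, a functional on `ω` is multiplication by some `q` with `q C ⊆ R`, that is, `q ∈
    -- 1 / C`.
    obtain ⟨q, hq⟩ := exists_eq_mul_of_linearMap
      (Algebra.linearMap R K ∘ₗ f ∘ₗ e.toLinearMap)
    rintro _ ⟨_, ⟨x, rfl⟩, rfl⟩
    obtain ⟨c, rfl⟩ := e.surjective x
    refine (hq c).symm ▸ Submodule.mul_mem_mul (Submodule.mem_div_iff_forall_mul_mem.2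
      fun y hy ↦ ?_) c.2
    exact Submodule.mem_one.2 ⟨f (e ⟨y, hy⟩), hq ⟨y, hy⟩⟩
  · refine Submodule.mul_le.2 fun q hq c hc ↦ ?_
    let g : C →ₗ[R] K := LinearMap.mulLeft R q ∘ₗ C.subtype
    have hg (y : C) : g y ∈ LinearMap.range (Algebra.linearMap R K) :=
      Submodule.mem_one.1 (Submodule.mem_div_iff_forall_mul_mem.1 hq y y.2)
    let i : R ≃ₗ[R] LinearMap.range (Algebra.linearMap R K) :=
      LinearEquiv.ofInjective (Algebra.linearMap R K) (IsFractionRing.injective R K)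
    let f : ω →ₗ[R] R := i.symm.toLinearMap ∘ₗ g.codRestrict _ hg ∘ₗ e.symm.toLinearMap
    refine (IsLocalization.mem_coeSubmodule K _).2 ⟨f (e ⟨c, hc⟩),
      (le_iSup (fun f : ω →ₗ[R] R ↦ LinearMap.range f) f) ⟨_, rfl⟩, ?_⟩
    have : i (f (e ⟨c, hc⟩)) = g.codRestrict _ hg ⟨c, hc⟩ := by
      simp only [f, LinearMap.comp_apply, LinearEquiv.coe_coe, LinearEquiv.apply_symm_apply,
        LinearEquiv.symm_apply_apply]
    exact congrArg Subtype.val this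

end TraceIdeal

lemma Submodule.div_div_eq_div_mul {R A : Type*} [CommSemiring R] [CommSemiring A] [Algebra R A]
    (I J L : Submodule R A) : I / J / L = I / (J * L) := by
  apply le_antisymm
  · rw [Submodule.le_div_iff_mul_le, mul_comm J, ← mul_assoc, ← Submodule.le_div_iff_mul_le,
      ← Submodule.le_div_iff_mul_le]
  · rw [Submodule.le_div_iff_mul_le, Submodule.le_div_iff_mul_le, mul_assoc, mul_comm L,
      ← Submodule.le_div_iff_mul_le]

/-! ### The three conditions over a domain. -/

section FarFlung

variable {R : Type u} [CommRing R]

lemma integralClosureSubmodule_mul_self {Q : Type v} [CommRing Q] [Algebra R Q] :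
    integralClosureSubmodule R Q * integralClosureSubmodule R Q = integralClosureSubmodule R Q :=
  le_antisymm (Submodule.mul_le.2 fun _ hx _ hy ↦ (integralClosure R Q).mul_mem hx hy)
    fun x hx ↦ by
      simpa using Submodule.mul_mem_mul (N := integralClosureSubmodule R Q) hx
        (one_mem (integralClosure R Q))

lemma one_le_integralClosureSubmodule {Q : Type v} [CommRing Q] [Algebra R Q] :
    1 ≤ integralClosureSubmodule R Q :=
  Submodule.one_le.2 (one_mem (integralClosure R Q))

lemma Submodule.div_le_div_left_of_le {A : Type*} [CommRing A] [Algebra R A]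
    {I J L : Submodule R A} (h : J ≤ L) : I / L ≤ I / J := fun _ hx ↦
  Submodule.mem_div_iff_forall_mul_mem.2 fun y hy ↦
    Submodule.mem_div_iff_forall_mul_mem.1 hx y (h hy)

lemma Submodule.le_mul_of_one_le {A : Type*} [CommRing A] [Algebra R A]
    {I J : Submodule R A} (h : 1 ≤ J) : I ≤ I * J := by
  simpa using mul_le_mul_right h I

variable [IsDomain R]

/-- The isomorphism is a multiplication, so the trace ideal is `q B`: a `B`-stable subset of `R`,
hence inside `1 / B`. Conversely `1 / B ≤ 1 / C ≤ (1 / C) * C`, because `1 ≤ C ≤ B`. -/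
theorem isFarFlungGorenstein_of_linearEquiv {K : Type v} [Field K] [Algebra R K]
    [IsFractionRing R K] {C : Submodule R K} (h1C : 1 ≤ C) (hCR : C ≤ integralClosureSubmodule R K)
    {ω : Type u} [AddCommGroup ω] [Module R ω] (e : C ≃ₗ[R] ω)
    (g : traceIdeal R ω ≃ₗ[R] integralClosure R K) : IsFarFlungGorenstein R ω K := by
  let f : integralClosureSubmodule R K →ₗ[R] K :=
    Algebra.linearMap R K ∘ₗ (traceIdeal R ω).subtype ∘ₗ g.symm.toLinearMap
  obtain ⟨q, hq⟩ := exists_eq_mul_of_linearMap f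
  rw [IsFarFlungGorenstein]
  apply le_antisymm
  · intro x hx
    obtain ⟨r, hr, rfl⟩ := (IsLocalization.mem_coeSubmodule K _).1 hx
    refine Submodule.mem_div_iff_forall_mul_mem.2 fun b hb ↦ ?_
    have hr' : algebraMap R K r = q * (g ⟨r, hr⟩ : K) := by
      refine Eq.trans ?_ (hq (g ⟨r, hr⟩))
      change _ = algebraMap R K (g.symm (g ⟨r, hr⟩) : traceIdeal R ω)
      rw [g.symm_apply_apply]
    have hb' : (g ⟨r, hr⟩ : K) * b ∈ integralClosureSubmodule R K :=
      (integralClosure R K).mul_mem (g ⟨r, hr⟩).2 hb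
    rw [hr', mul_assoc]
    exact Submodule.mem_one.2 ⟨_, hq ⟨_, hb'⟩⟩
  · rw [coeSubmodule_traceIdeal_eq e]
    exact (Submodule.div_le_div_left_of_le hCR).trans (Submodule.le_mul_of_one_le h1C)

/-- A local Dedekind domain is principal, so the conductor, an ideal of `B`, is `c B`;
multiplication by `c` is the isomorphism. -/
theorem IsFarFlungGorenstein.nonempty_linearEquiv [IsNoetherianRing R] [Ring.DimensionLEOne R]
    {K : Type v} [Field K] [Algebra R K] [IsFractionRing R K]
    (hfin : Module.Finite R (integralClosure R K)) (hloc : IsLocalRing (integralClosure R K))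
    {ω : Type u} [AddCommGroup ω] [Module R ω] (h : IsFarFlungGorenstein R ω K) :
    Nonempty (traceIdeal R ω ≃ₗ[R] integralClosure R K) := by
  have : IsNoetherianRing (integralClosure R K) := isNoetherian_of_tower R inferInstance
  have : IsIntegrallyClosed (integralClosure R K) :=
    integralClosure.isIntegrallyClosedOfFiniteExtension K
  have : IsDedekindDomain (integralClosure R K) := { }
  let 𝔠 : Ideal (integralClosure R K) :=
    { carrier := {x | (x : K) ∈ (1 : Submodule R K) / integralClosureSubmodule R K}
      add_mem' := fun hx hy ↦
        Submodule.add_mem ((1 : Submodule R K) / integralClosureSubmodule R K) hx hy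
      zero_mem' := Submodule.zero_mem ((1 : Submodule R K) / integralClosureSubmodule R K)
      smul_mem' := fun b x hx ↦ Submodule.mem_div_iff_forall_mul_mem.2 fun y hy ↦ by
        have := Submodule.mem_div_iff_forall_mul_mem.1 hx (b * y)
          ((integralClosure R K).mul_mem b.2 hy)
        convert this using 1
        simp only [smul_eq_mul, MulMemClass.coe_mul]
        ring }
  obtain ⟨c, hc⟩ := (IsPrincipalIdealRing.principal 𝔠).principal
  have hmem (x : K) (hx : x ∈ (1 : Submodule R K) / integralClosureSubmodule R K) :
      ∃ b : integralClosure R K, (c : K) * b = x := by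
    have hx1 : x ∈ (1 : Submodule R K) := by
      simpa using Submodule.mem_div_iff_forall_mul_mem.1 hx 1 (one_mem (integralClosure R K))
    have hx𝔠 : (⟨x, one_le_integralClosureSubmodule hx1⟩ : integralClosure R K) ∈ 𝔠 := hx
    rw [hc] at hx𝔠
    obtain ⟨b, hb⟩ := Ideal.mem_span_singleton'.1 hx𝔠
    exact ⟨b, by rw [mul_comm]; exact congrArg Subtype.val hb⟩
  -- The conductor is nonzero: it contains a common denominator of the finite module `B`.
  have hc0 : (c : K) ≠ 0 := by
    obtain ⟨s, hs, hsY⟩ := FractionalIdeal.isFractional_of_fg (S := nonZeroDivisors R)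
      (Module.Finite.iff_fg.1 hfin : (integralClosureSubmodule R K).FG)
    obtain ⟨b, hb⟩ := hmem (algebraMap R K s) (Submodule.mem_div_iff_forall_mul_mem.2 fun y hy ↦ by
      obtain ⟨r, hr⟩ := hsY y hy
      exact Submodule.mem_one.2 ⟨r, by rw [hr, Algebra.smul_def]⟩)
    rintro h0
    rw [h0, zero_mul, eq_comm] at hb
    exact nonZeroDivisors.ne_zero hs (by simpa using hb)
  let m : integralClosure R K →ₗ[R] K :=
    LinearMap.mulLeft R (c : K) ∘ₗ (integralClosureSubmodule R K).subtype
  have hm : Function.Injective m := fun a b hab ↦ Subtype.ext (mul_left_cancel₀ hc0 hab)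
  have hrange : LinearMap.range m = IsLocalization.coeSubmodule K (traceIdeal R ω) := by
    rw [IsFarFlungGorenstein] at h
    rw [h]
    ext x
    refine ⟨?_, fun hx ↦ hmem x hx⟩
    rintro ⟨b, rfl⟩
    have : c * b ∈ 𝔠 := by rw [hc]; exact Ideal.mem_span_singleton'.2 ⟨b, mul_comm _ _⟩
    exact this
  exact ⟨(Submodule.equivMapOfInjective _ (IsFractionRing.injective R K) _).trans
    ((LinearEquiv.ofEq _ _ hrange.symm).trans (LinearEquiv.ofInjective m hm).symm)⟩

/-- Replacing `1` by `C / C` turns both colons into duals: `1 / C = C / C ^ 2` and, since `C B = B`,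
`1 / B = C / B`. Separation then compares `C ^ 2` with `B`. -/
theorem isFarFlungGorenstein_iff_sq_eq [IsNoetherianRing R] [IsLocalRing R]
    [Ring.DimensionLEOne R] (hR : IsLocalRing.maximalIdeal R ≠ ⊥)
    {K : Type v} [Field K] [Algebra R K] [IsFractionRing R K] {C : Submodule R K}
    (h1C : 1 ≤ C) (hCR : C ≤ integralClosureSubmodule R K)
    (hfin : Module.Finite R (integralClosure R K))
    {ω : Type u} [AddCommGroup ω] [Module R ω] (e : C ≃ₗ[R] ω) (n : ℕ)
    [HasInjectiveDimensionLE (ModuleCat.of R ω) n] :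
    IsFarFlungGorenstein R ω K ↔ C ^ 2 = integralClosureSubmodule R K := by
  have hfg : (integralClosureSubmodule R K).FG := Module.Finite.iff_fg.1 hfin
  have : IsNoetherian R (integralClosureSubmodule R K) :=
    isNoetherian_of_fg_of_noetherian _ hfg
  have hC : C.FG := Submodule.FG.of_le hfg hCR
  have h1 : C / C = 1 := div_self_eq_one hR e n hC h1C
  have hCB : C * integralClosureSubmodule R K = integralClosureSubmodule R K := by
    apply le_antisymm
    · exact (mul_le_mul_left hCR _).trans integralClosureSubmodule_mul_self.le
    · rw [mul_comm]; exact Submodule.le_mul_of_one_le h1C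
  have hdC : 1 / C = C / C ^ 2 := by rw [← h1, Submodule.div_div_eq_div_mul, ← sq]
  have hdB : 1 / integralClosureSubmodule R K = C / integralClosureSubmodule R K := by
    rw [← h1, Submodule.div_div_eq_div_mul, hCB]
  have hCC : C ^ 2 ≤ integralClosureSubmodule R K := by
    rw [sq]; exact (mul_le_mul' hCR hCR).trans integralClosureSubmodule_mul_self.le
  have hle : 1 / integralClosureSubmodule R K ≤ 1 / C := Submodule.div_le_div_left_of_le hCR
  rw [IsFarFlungGorenstein, coeSubmodule_traceIdeal_eq e]
  constructor
  · intro h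
    refine eq_of_div_eq_div hR e n hC h1C hfg hCC ?_
    rw [← hdC, ← hdB]
    -- `1 / C` lies in the trace ideal `(1 / C) * C`, which is now `1 / B`.
    exact le_antisymm ((Submodule.le_mul_of_one_le h1C).trans h.le) hle
  · intro h
    have hd : 1 / C = 1 / integralClosureSubmodule R K := by rw [hdC, hdB, h]
    rw [hd]
    refine le_antisymm ?_ (Submodule.le_mul_of_one_le h1C)
    rw [Submodule.le_div_iff_mul_le, mul_assoc, hCB, ← Submodule.le_div_iff_mul_le]

end FarFlung

/-! ### The total ring of fractions is a field. -/

section TotalRingOfFractions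

variable {R : Type u} [CommRing R]

/-- Nilpotents are integral, so the nilradical is finitely generated over `R`; as `s` is a unit in
`Q`, multiplication by `s` maps it onto itself, and Nakayama kills it. -/
lemma isReduced_of_finite_integralClosure [IsNoetherianRing R] [IsLocalRing R] {s : R}
    (hs : s ∈ nonZeroDivisors R) (hsm : s ∈ IsLocalRing.maximalIdeal R)
    {Q : Type v} [CommRing Q] [Algebra R Q] [IsFractionRing R Q]
    (hfin : Module.Finite R (integralClosure R Q)) : IsReduced Q := by
  have hfg : (integralClosureSubmodule R Q).FG := Module.Finite.iff_fg.1 hfin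
  have : IsNoetherian R (integralClosureSubmodule R Q) :=
    isNoetherian_of_fg_of_noetherian _ hfg
  let N : Submodule R Q := (nilradical Q).restrictScalars R
  have hN : N ≤ integralClosureSubmodule R Q := fun x ⟨n, hn⟩ ↦
    IsIntegral.of_pow (n := n + 1) n.succ_pos (by rw [pow_succ, hn, zero_mul]; exact isIntegral_zero)
  obtain ⟨u, hu⟩ := IsLocalization.map_units Q (⟨s, hs⟩ : nonZeroDivisors R)
  have hbot : N = ⊥ := Submodule.eq_bot_of_le_smul_of_le_jacobson_bot
    (IsLocalRing.maximalIdeal R) _ (Submodule.FG.of_le hfg hN)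
    (fun y hy ↦ by
      have : s • ((↑u⁻¹ : Q) * y) ∈ IsLocalRing.maximalIdeal R • N :=
        Submodule.smul_mem_smul hsm (Ideal.mul_mem_left (nilradical Q) _ hy)
      rwa [Algebra.smul_def s, ← hu, Units.mul_inv_cancel_left] at this)
    (IsLocalRing.maximalIdeal_le_jacobson _)
  refine ⟨fun x hx ↦ ?_⟩
  have : x ∈ N := hx
  simpa [hbot] using this

/-- Primes of `Q` contract to primes avoiding `s`, hence not maximal, hence minimal. Nested primes
of `Q` therefore have equal contractions and coincide. -/
lemma krullDimLE_zero_of_isFractionRing [IsLocalRing R] [Ring.KrullDimLE 1 R] {s : R}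
    (hs : s ∈ nonZeroDivisors R) (hsm : s ∈ IsLocalRing.maximalIdeal R)
    {Q : Type v} [CommRing Q] [Algebra R Q] [IsFractionRing R Q] : Ring.KrullDimLE 0 Q := by
  have key (p : Ideal Q) [hp : p.IsPrime] : p.comap (algebraMap R Q) ∈ minimalPrimes R := by
    refine (Ring.krullDimLE_one_iff.1 inferInstance _ inferInstance).resolve_right fun hmax ↦ ?_
    have : s ∈ p.comap (algebraMap R Q) := IsLocalRing.eq_maximalIdeal hmax ▸ hsm
    exact hp.ne_top (Ideal.eq_top_of_isUnit_mem _ this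
      (IsLocalization.map_units Q (⟨s, hs⟩ : nonZeroDivisors R)))
  refine .mk₀ fun p hp ↦ ?_
  obtain ⟨m, hm, hpm⟩ := p.exists_le_maximal hp.ne_top
  have hle : p.under R = m.under R :=
    (Ideal.comap_mono hpm).antisymm ((key m).2 ⟨inferInstance, bot_le⟩ (Ideal.comap_mono hpm))
  rw [← IsLocalization.map_under (nonZeroDivisors R) Q p, hle,
    IsLocalization.map_under (nonZeroDivisors R) Q m]
  exact hm

/-- The Artinian property gives `x ^ n = x ^ (n + 1) * y`; reducedness improves this to `x = x ^ 2 *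
y`, making `x * y` idempotent. -/
lemma isField_of_forall_isIdempotentElem {Q : Type v} [CommRing Q] [Nontrivial Q] [IsReduced Q]
    [IsArtinianRing Q] (h : ∀ e : Q, IsIdempotentElem e → e = 0 ∨ e = 1) : IsField Q := by
  refine ⟨Nontrivial.exists_pair_ne, mul_comm, fun {x} hx ↦ ?_⟩
  obtain ⟨n, y, hy⟩ := IsArtinian.exists_pow_succ_smul_dvd x (1 : Q)
  simp only [smul_eq_mul, mul_one] at hy
  have hxy : x * (1 - x * y) = 0 := by
    refine IsReduced.eq_zero _ ⟨n + 1, ?_⟩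
    rw [mul_pow, pow_succ, pow_succ (1 - x * y)]
    have : x ^ n * (1 - x * y) = 0 := by
      rw [mul_sub, mul_one, ← mul_assoc, ← pow_succ]
      exact sub_eq_zero.2 hy.symm
    linear_combination (x * (1 - x * y) ^ n) * this
  rcases h (x * y) (by rw [IsIdempotentElem]; linear_combination (-y) * hxy) with h | h
  · rw [h, sub_zero, mul_one] at hxy
    exact absurd hxy hx
  · exact ⟨y, h⟩

/-- The total ring of fractions of a one-dimensional Cohen-Macaulay local ring is a field, if the
normalization is finite and local. -/
theorem isField_of_isLocalRing_integralClosure [IsNoetherianRing R] [IsLocalRing R]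
    [Ring.KrullDimLE 1 R] {s : R}
    (hs : s ∈ nonZeroDivisors R) (hsm : s ∈ IsLocalRing.maximalIdeal R)
    {Q : Type v} [CommRing Q] [Algebra R Q] [IsFractionRing R Q]
    (hfin : Module.Finite R (integralClosure R Q)) (hloc : IsLocalRing (integralClosure R Q)) :
    IsField Q := by
  have := krullDimLE_zero_of_isFractionRing hs hsm (Q := Q)
  have : IsNoetherianRing Q := IsLocalization.isNoetherianRing (nonZeroDivisors R) Q ‹_›
  have : IsArtinianRing Q := isArtinianRing_iff_isNoetherianRing_krullDimLE_zero.2 ⟨‹_›, ‹_›⟩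
  have := isReduced_of_finite_integralClosure hs hsm hfin
  have : Nontrivial Q := (IsFractionRing.injective R Q).nontrivial
  refine isField_of_forall_isIdempotentElem fun e he ↦ ?_
  -- An idempotent is a root of the monic `X ^ 2 - X`, so it already lies in the local ring `B`.
  have heB : e ∈ integralClosure R Q := by
    refine ⟨Polynomial.X ^ 2 - Polynomial.X, by monicity!, ?_⟩
    simp [sq, he.eq]
  let b : integralClosure R Q := ⟨e, heB⟩
  have hb : b * (1 - b) = 0 := Subtype.ext (by
    change e * (1 - e) = 0
    rw [mul_sub, he.eq, mul_one, sub_self])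
  rcases IsLocalRing.isUnit_or_isUnit_of_add_one (add_sub_cancel b 1) with h | h
  · right
    have := (h.mul_right_eq_zero).1 hb
    exact (sub_eq_zero.1 (congrArg Subtype.val this)).symm
  · left
    exact congrArg Subtype.val ((h.mul_left_eq_zero).1 hb)

lemma IsCohenMacaulayLocalRing.exists_mem_nonZeroDivisors [IsLocalRing R]
    (h : IsCohenMacaulayLocalRing R) (hdim : ringKrullDim R = 1) :
    ∃ s ∈ nonZeroDivisors R, s ∈ IsLocalRing.maximalIdeal R := by
  obtain ⟨-, -, rs, hlen, hmem, hreg⟩ := h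
  rw [hdim] at hlen
  obtain ⟨s, rfl⟩ := List.length_eq_one_iff.1 (by exact_mod_cast hlen : rs.length = 1)
  refine ⟨s, ?_, hmem s (by simp)⟩
  have := ((RingTheory.Sequence.isWeaklyRegular_cons_iff R s []).1 hreg.toIsWeaklyRegular).1
  exact mem_nonZeroDivisors_iff_right.2 fun x hx ↦ this (by simpa [mul_comm] using hx)

end TotalRingOfFractions

theorem mainTheorem1
    {R : Type u} [CommRing R] [IsLocalRing R]
    (hCM : IsCohenMacaulayLocalRing R) (hdim : ringKrullDim R = 1)
    {ω : Type u} [AddCommGroup ω] [Module R ω] (hω : IsCanonicalModule R ω)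
    {Q : Type v} [CommRing Q] [Algebra R Q] [IsFractionRing R Q]
    (C : Submodule R Q) (hRC : 1 ≤ C) (hCR : C ≤ integralClosureSubmodule R Q)
    (hCω : Nonempty (C ≃ₗ[R] ω))
    (hfin : Module.Finite R (integralClosure R Q))
    (hloc : IsLocalRing (integralClosure R Q)) :
    List.TFAE [
      IsFarFlungGorenstein R ω Q,
      Nonempty (traceIdeal R ω ≃ₗ[R] integralClosure R Q),
      C ^ 2 = integralClosureSubmodule R Q] := by
  have := hCM.1
  have : Ring.KrullDimLE 1 R := (Order.krullDimLE_iff _ _).2 hdim.le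
  obtain ⟨s, hs, hsm⟩ := hCM.exists_mem_nonZeroDivisors hdim
  let : Field Q := (isField_of_isLocalRing_integralClosure hs hsm hfin hloc).toField
  have : IsDomain R := (IsFractionRing.injective R Q).isDomain (algebraMap R Q)
  have : Ring.DimensionLEOne R := ⟨fun h hp ↦ hp.isMaximal_of_ne_bot h⟩
  have hR : IsLocalRing.maximalIdeal R ≠ ⊥ := fun h ↦
    nonZeroDivisors.ne_zero hs (by simpa [h] using hsm)
  obtain ⟨e⟩ := hCω
  obtain ⟨n, hn⟩ := hω.finite_injectiveDimension
  tfae_have 1 ↔ 3 := isFarFlungGorenstein_iff_sq_eq hR hRC hCR hfin e n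
  tfae_have 1 → 2 := fun h ↦ h.nonempty_linearEquiv hfin hloc
  tfae_have 2 → 1 := fun ⟨g⟩ ↦ isFarFlungGorenstein_of_linearEquiv hRC hCR e g
  tfae_finish
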